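/- Let $Y_1,Y_2,\ldots$ be independent random variables with values in $\{0,1\}$ and constant success probability $\mathbb P(Y_\ell=1)=p\in(0,1)$ for all $\ell\ge 1$ (the null hypothesis $H_0$). Let $d\ge 3$ be an integer, $q=\lfloor (d-1)/2\rfloor$, and for $1\le i\le d$ and $n\ge d$ put $$Z_i^n=\frac1{\lfloor n/d\rfloor}\sum_{k=0}^{\lfloor n/d\rfloor-1}Y_{i+kd}.$$ For $x=(x_1,\ldots,x_d)\in\mathbb R^d$ and $1\le j\le q$ let $$I_x(\omega_j)=\frac1d\Bigl|\sum_{\ell=1}^d x_\ell e^{-\mathrm i\ell\omega_j}\Bigr|^2,\qquad \omega_j=\frac{2\pi j}{d},$$ let $A=\{x\in\mathbb R^d : I_x(\omega_1)=\cdots=I_x(\omega_q)=0\}$, and let $$g(x)=\frac{\max_{1\le j\le q}I_x(\omega_j)}{\sum_{m=1}^q I_x(\omega_m)}\quad (x\notin A),\qquad f(x)=\begin{cases} g(x), & x\notin A,\\ 0, & x\in A.\end{cases}$$ (a) If $N_1,\ldots,N_d$ are i.i.d. standard normal random variables, then $(N_1,\ldots,N_d)\notin A$ almost surely, and, as $n\to\infty$,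 $$f(Z_1^n,\ldots,Z_d^n)\longrightarrow g(N_1,\ldots,N_d)\quad\text{in law}.$$ (b) Let $\alpha\in(0,1)$ and consider the equation $$\sum_{j=1}^q(-1)^{j+1}\binom qj(1-jk)_+^{q-1}=\alpha,\qquad k\in\mathbb R,$$ where $x_+=\max\{x,0\}$ and $0^0=1$. If $d\ge5$ (that is, $q\ge2$), it has exactly one solution. Whenever $k_\alpha$ is a solution, the test that rejects $H_0$ when $f(Z_1^n,\ldots,Z_d^n)>k_\alpha$ has asymptotic level $\alpha$ under $H_0$: $$\lim_{n\to\infty}\mathbb P\bigl(f(Z_1^n,\ldots,Z_d^n)>k_\alpha\bigr)=\alpha .$$ -/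

import Mathlib

open MeasureTheory ProbabilityTheory Filter Topology

namespace BinaryPeriodicity

/- Indexing: the observation `Y ℓ` (`ℓ : ℕ`, from `0`) is the `(ℓ + 1)`-st one, and a time series
`x : Fin d → ℝ` lists its `d` entries from `0`, so `x ℓ` is the `(ℓ + 1)`-st entry. The Fourier
frequencies keep their usual indices `1, …, q`. -/

/-- The number `q = ⌊(d - 1) / 2⌋` of Fourier frequencies in use (meant for `d ≥ 1`). -/
def numFreq (d : ℕ) : ℕ := (d - 1) / 2

/-- The `j`-th Fourier frequency `ω_j = 2πj / d` of a time series of length `d`. -/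
noncomputable def fourierFreq (d j : ℕ) : ℝ := 2 * Real.pi * j / d

/-- The periodogram `I_x(ω_j) = (1/d) |∑_{ℓ=1}^d x_ℓ exp(-i ℓ ω_j)|²`. -/
noncomputable def periodogram {d : ℕ} (x : Fin d → ℝ) (j : ℕ) : ℝ :=
  (1 / d : ℝ) *
    ‖∑ ℓ : Fin d, (x ℓ : ℂ) *
      Complex.exp (-Complex.I * (((ℓ : ℕ) + 1 : ℕ) : ℂ) * (fourierFreq d j : ℂ))‖ ^ 2

/-- The set `A` of time series all of whose periodograms at `ω_1, …, ω_q` vanish. -/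
def degenerateSet (d : ℕ) : Set (Fin d → ℝ) :=
  {x | ∀ j ∈ Finset.Icc 1 (numFreq d), periodogram x j = 0}

/-- Fisher's `g`: the largest of the periodograms at `ω_1, …, ω_q` divided by their sum. It is
meaningful outside `degenerateSet d`. -/
noncomputable def fisherG {d : ℕ} (x : Fin d → ℝ) : ℝ :=
  (⨆ j : Finset.Icc 1 (numFreq d), periodogram x j) /
    ∑ m ∈ Finset.Icc 1 (numFreq d), periodogram x m

/-- The function `f`, equal to Fisher's `g` outside `A` and to `0` on `A`. -/
noncomputable def fisherF {d : ℕ} (x : Fin d → ℝ) : ℝ :=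
  (degenerateSet d)ᶜ.indicator fisherG x

/-- The transformed time series `Z_i^n = ⌊n/d⌋⁻¹ ∑_{k=0}^{⌊n/d⌋-1} Y_{i+kd}`, `1 ≤ i ≤ d`. -/
noncomputable def blockMean {Ω : Type*} (Y : ℕ → Ω → ℝ) (d n : ℕ) (ω : Ω) : Fin d → ℝ :=
  fun i => (1 / ((n / d : ℕ) : ℝ)) * ∑ k ∈ Finset.range (n / d), Y ((i : ℕ) + k * d) ω

/-- The function `x ↦ ∑_{j=1}^q (-1)^{j+1} C(q,j) (1 - jx)_+^{q-1}`. -/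
noncomputable def fisherTail (q : ℕ) (x : ℝ) : ℝ :=
  ∑ j ∈ Finset.Icc 1 q, (-1 : ℝ) ^ (j + 1) * (q.choose j : ℝ) * (max (1 - j * x) 0) ^ (q - 1)

end BinaryPeriodicity

/- Subtracting a constant from all observations and rescaling them changes neither the set `A` nor
Fisher's statistic, because the frequencies `ω_1, …, ω_q` exclude `0`. The block means may therefore
be replaced by normalized block sums, which converge to a Gaussian vector by the central limit
theorem; Fisher's statistic is continuous off the null set `A`, so the continuous mapping theorem
applies. The rows `cos (ℓ ω_j)` and `sin (ℓ ω_j)` are orthogonal of the same length, so the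
periodograms of a standard normal vector are i.i.d. exponential, and `fisherTail` is the tail of the
largest of `q` exponential variables relative to their sum: the event that all the ratios with
indices in `J` exceed `k` has probability `(1 - |J| k)_+ ^ (q - 1)` by a linear change of variables,
and inclusion–exclusion gives their union. This tail falls strictly from `1` to `0` as `k` runs
through `[1/q, 1]`, since the exponential law charges every open set of the orthant. -/

namespace BinaryPeriodicity

lemma lintegral_Ioi_eq_lintegral_mul_comp_sq (h : ℝ → ENNReal) :
    ∫⁻ t in Set.Ioi 0, h t = ∫⁻ r in Set.Ioi 0, ENNReal.ofReal (2 * r) * h (r ^ 2) := by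
  have himage : (fun r : ℝ => r ^ 2) '' Set.Ioi 0 = Set.Ioi 0 :=
    Set.Subset.antisymm (Set.image_subset_iff.2 fun r hr => pow_pos (Set.mem_Ioi.1 hr) 2)
      fun t ht => ⟨√t, Real.sqrt_pos.2 ht, Real.sq_sqrt (le_of_lt ht)⟩
  have hmono : MonotoneOn (fun r : ℝ => r ^ 2) (Set.Ioi 0) := fun r hr _ _ hrs =>
    pow_le_pow_left₀ (le_of_lt hr) hrs 2
  have hderiv (r : ℝ) : HasDerivWithinAt (fun r : ℝ => r ^ 2) (2 * r) (Set.Ioi 0) r := by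
    simpa using (hasDerivAt_pow 2 r).hasDerivWithinAt
  have hsubst := lintegral_image_eq_lintegral_deriv_mul_of_monotoneOn measurableSet_Ioi
    (fun r _ => hderiv r) hmono h
  rwa [himage] at hsubst

lemma lintegral_comp_sq_add_sq {h : ℝ → ENNReal} (hh : Measurable h) :
    ∫⁻ p : ℝ × ℝ, h (p.1 ^ 2 + p.2 ^ 2) =
      ENNReal.ofReal Real.pi * ∫⁻ t in Set.Ioi 0, h t := by
  have hradius (p : ℝ × ℝ) :
      (polarCoord.symm p).1 ^ 2 + (polarCoord.symm p).2 ^ 2 = p.1 ^ 2 := by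
    rw [polarCoord_symm_apply]
    linear_combination p.1 ^ 2 * Real.cos_sq_add_sin_sq p.2
  have htarget : (volume : Measure (ℝ × ℝ)).restrict polarCoord.target =
      (volume.restrict (Set.Ioi 0)).prod (volume.restrict (Set.Ioo (-Real.pi) Real.pi)) := by
    rw [Measure.prod_restrict]; rfl
  calc ∫⁻ p : ℝ × ℝ, h (p.1 ^ 2 + p.2 ^ 2)
      = ∫⁻ p in polarCoord.target, ENNReal.ofReal p.1 * h (p.1 ^ 2) * 1 := by
        rw [← lintegral_comp_polarCoord_symm]
        simp only [hradius, smul_eq_mul, mul_one]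
    _ = (∫⁻ r in Set.Ioi 0, ENNReal.ofReal r * h (r ^ 2)) * ENNReal.ofReal (2 * Real.pi) := by
        rw [htarget, lintegral_prod_mul (f := fun r : ℝ => ENNReal.ofReal r * h (r ^ 2))
          (g := fun _ => 1) (by fun_prop) aemeasurable_const, setLIntegral_one, Real.volume_Ioo,
          sub_neg_eq_add, two_mul]
    _ = ENNReal.ofReal Real.pi * ∫⁻ t in Set.Ioi 0, h t := by
        rw [lintegral_Ioi_eq_lintegral_mul_comp_sq h, mul_comm, mul_comm 2, ENNReal.ofReal_mul
          Real.pi_nonneg, mul_assoc, ← lintegral_const_mul _ (by fun_prop)]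
        simp only [ENNReal.ofReal_mul zero_le_two, mul_assoc]

lemma expMeasure_eq_withDensity (r : ℝ) :
    expMeasure r = (volume.restrict (Set.Ioi 0)).withDensity
      fun t => ENNReal.ofReal (r * Real.exp (-(r * t))) := by
  rw [Measure.restrict_congr_set Ioi_ae_eq_Ici, ← withDensity_indicator measurableSet_Ici]
  change volume.withDensity (exponentialPDF r) = _
  congr 1 with t
  rw [exponentialPDF_eq, Set.indicator_apply, apply_ite ENNReal.ofReal, ENNReal.ofReal_zero]
  rfl

lemma gaussianReal_zero_prod_self_eq_withDensity {v : NNReal} (hv : v ≠ 0) :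
    (gaussianReal 0 v).prod (gaussianReal 0 v) = (volume : Measure (ℝ × ℝ)).withDensity fun p =>
      ENNReal.ofReal ((2 * Real.pi * v)⁻¹ * Real.exp (-((2 * v : ℝ)⁻¹ * (p.1 ^ 2 + p.2 ^ 2)))) := by
  have hsqrt : (√(2 * Real.pi * v))⁻¹ * (√(2 * Real.pi * v))⁻¹ = (2 * Real.pi * v)⁻¹ := by
    rw [← mul_inv, Real.mul_self_sqrt (by positivity)]
  rw [gaussianReal_of_var_ne_zero _ hv,
    prod_withDensity (measurable_gaussianPDF _ _) (measurable_gaussianPDF _ _)]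
  congr 1 with p
  rw [gaussianPDF, gaussianPDF, gaussianPDFReal, gaussianPDFReal,
    ← ENNReal.ofReal_mul (by positivity), mul_mul_mul_comm, hsqrt, ← Real.exp_add]
  congr 3
  ring

lemma map_sq_add_sq_gaussianReal {v : NNReal} (hv : v ≠ 0) :
    ((gaussianReal 0 v).prod (gaussianReal 0 v)).map (fun p : ℝ × ℝ => p.1 ^ 2 + p.2 ^ 2) =
      expMeasure (2 * v : ℝ)⁻¹ := by
  have hmeas : Measurable fun p : ℝ × ℝ => p.1 ^ 2 + p.2 ^ 2 := by fun_prop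
  have hconst : Real.pi * (2 * Real.pi * v)⁻¹ = (2 * v : ℝ)⁻¹ := by
    have := Real.pi_ne_zero
    field_simp
  ext s hs
  calc ((gaussianReal 0 v).prod (gaussianReal 0 v)).map (fun p => p.1 ^ 2 + p.2 ^ 2) s
      = ∫⁻ p : ℝ × ℝ, s.indicator (fun t => ENNReal.ofReal ((2 * Real.pi * v)⁻¹ *
          Real.exp (-((2 * v : ℝ)⁻¹ * t)))) (p.1 ^ 2 + p.2 ^ 2) := by
        rw [Measure.map_apply hmeas hs, gaussianReal_zero_prod_self_eq_withDensity hv,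
          withDensity_apply _ (hmeas hs), ← lintegral_indicator (hmeas hs)]
        rfl
    _ = ∫⁻ t in s, ENNReal.ofReal ((2 * v : ℝ)⁻¹ * Real.exp (-((2 * v : ℝ)⁻¹ * t)))
          ∂volume.restrict (Set.Ioi 0) := by
        rw [lintegral_comp_sq_add_sq (Measurable.indicator (by fun_prop) hs),
          lintegral_indicator hs, ← lintegral_const_mul _ (by fun_prop)]
        simp only [← ENNReal.ofReal_mul Real.pi_nonneg, ← mul_assoc, hconst]
    _ = expMeasure (2 * v : ℝ)⁻¹ s := by
        rw [expMeasure_eq_withDensity, withDensity_apply _ hs]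

section Exponential

variable {ι : Type*}

/-- The open positive orthant of `ℝ^ι`, which carries products of exponential distributions. -/
def posOrthant (ι : Type*) : Set (ι → ℝ) := {x | ∀ i, 0 < x i}

lemma posOrthant_eq_pi : posOrthant ι = Set.univ.pi fun _ => Set.Ioi 0 := by
  ext x; simp [posOrthant]

lemma isOpen_posOrthant [Finite ι] : IsOpen (posOrthant ι) := by
  rw [posOrthant_eq_pi]
  exact isOpen_set_pi Set.finite_univ fun _ _ => isOpen_Ioi

variable [Fintype ι]

lemma pi_expMeasure_eq_withDensity {r : ℝ} (hr : 0 < r) :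
    Measure.pi (fun _ : ι => expMeasure r) = (volume.restrict (posOrthant ι)).withDensity
      fun x => ENNReal.ofReal (r ^ Fintype.card ι * Real.exp (-(r * ∑ i, x i))) := by
  have : IsProbabilityMeasure (expMeasure r) := isProbabilityMeasure_expMeasure hr
  have hnonneg (t : ℝ) : 0 ≤ r * Real.exp (-(r * t)) := by positivity
  have hint (s : Set ℝ) : Integrable (fun t => r * Real.exp (-(r * t)))
      ((volume.restrict (Set.Ioi 0)).restrict s) := by
    simpa only [neg_mul] using ((integrableOn_exp_mul_Ioi (neg_lt_zero.2 hr) 0).integrable.const_mul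
      r).restrict
  have hprod (x : ι → ℝ) :
      r ^ Fintype.card ι * Real.exp (-(r * ∑ i, x i)) = ∏ i, r * Real.exp (-(r * x i)) := by
    rw [Finset.prod_mul_distrib, Finset.prod_const, Finset.card_univ, ← Real.exp_sum,
      Finset.sum_neg_distrib, Finset.mul_sum]
  refine Measure.pi_eq fun s hs => ?_
  rw [withDensity_apply _ (MeasurableSet.univ_pi hs), posOrthant_eq_pi, volume_pi,
    Measure.restrict_pi_pi, Measure.restrict_pi_pi]
  simp_rw [hprod]
  rw [← ofReal_integral_eq_lintegral_ofReal
      (Integrable.fintype_prod (f := fun _ t => r * Real.exp (-(r * t))) fun i => hint (s i))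
      (ae_of_all _ fun x => Finset.prod_nonneg fun i _ => hnonneg _),
    integral_fintype_prod_eq_prod fun _ t => r * Real.exp (-(r * t)),
    ENNReal.ofReal_prod_of_nonneg fun i _ => integral_nonneg hnonneg]
  refine Finset.prod_congr rfl fun i _ => ?_
  rw [expMeasure_eq_withDensity, withDensity_apply _ (hs i),
    ofReal_integral_eq_lintegral_ofReal (hint _) (ae_of_all _ hnonneg)]

lemma ae_mem_posOrthant_pi_expMeasure {r : ℝ} (hr : 0 < r) :
    ∀ᵐ x ∂Measure.pi (fun _ : ι => expMeasure r), x ∈ posOrthant ι := by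
  rw [pi_expMeasure_eq_withDensity hr]
  exact (withDensity_absolutelyContinuous _ _).ae_le
    (ae_restrict_mem isOpen_posOrthant.measurableSet)

lemma pi_expMeasure_apply {r : ℝ} (hr : 0 < r) {s : Set (ι → ℝ)} (hs : MeasurableSet s) :
    Measure.pi (fun _ : ι => expMeasure r) s = ∫⁻ x in s ∩ posOrthant ι,
      ENNReal.ofReal (r ^ Fintype.card ι * Real.exp (-(r * ∑ i, x i))) := by
  rw [pi_expMeasure_eq_withDensity hr, withDensity_apply _ hs, Measure.restrict_restrict hs]

lemma pi_expMeasure_pos_of_isOpen {r : ℝ} (hr : 0 < r) {U : Set (ι → ℝ)} (hU : IsOpen U)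
    (hne : (U ∩ posOrthant ι).Nonempty) : 0 < Measure.pi (fun _ : ι => expMeasure r) U := by
  have hsupp : Function.support (fun x : ι → ℝ =>
      ENNReal.ofReal (r ^ Fintype.card ι * Real.exp (-(r * ∑ i, x i)))) = Set.univ :=
    Set.eq_univ_of_forall fun x => (ENNReal.ofReal_pos.2 (by positivity)).ne'
  rw [pi_expMeasure_apply hr hU.measurableSet, setLIntegral_pos_iff (by fun_prop), hsupp,
    Set.univ_inter]
  exact (hU.inter isOpen_posOrthant).measure_pos volume hne

lemma setLIntegral_posOrthant_exp_neg_mul_sum {r : ℝ} (hr : 0 < r) :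
    ∫⁻ x in posOrthant ι, ENNReal.ofReal (r ^ Fintype.card ι * Real.exp (-(r * ∑ i, x i))) = 1 := by
  have : IsProbabilityMeasure (expMeasure r) := isProbabilityMeasure_expMeasure hr
  rw [← Set.univ_inter (posOrthant ι), ← pi_expMeasure_apply hr MeasurableSet.univ, measure_univ]

/-- The linear map `x ↦ x - (∑ i, x i) • v`. For `v ≥ 0` it turns the spacing conditions
`v i * ∑ l, x l < x i` into positivity of the coordinates. -/
noncomputable def subSumSMul (v : ι → ℝ) : (ι → ℝ) →ₗ[ℝ] (ι → ℝ) :=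
  LinearMap.transvection (∑ i, LinearMap.proj i) (-v)

lemma subSumSMul_apply (v x : ι → ℝ) (i : ι) : subSumSMul v x i = x i - v i * ∑ l, x l := by
  simp [subSumSMul, LinearMap.transvection.apply, LinearMap.sum_apply, mul_comm, sub_eq_add_neg]

lemma det_subSumSMul (v : ι → ℝ) : LinearMap.det (subSumSMul v) = 1 - ∑ i, v i := by
  simp [subSumSMul, LinearMap.sum_apply, sub_eq_add_neg]

lemma sum_subSumSMul (v x : ι → ℝ) :
    ∑ i, subSumSMul v x i = (1 - ∑ i, v i) * ∑ i, x i := by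
  simp only [subSumSMul_apply, Finset.sum_sub_distrib, ← Finset.sum_mul, sub_mul, one_mul]

lemma lintegral_comp_subSumSMul {v : ι → ℝ} (hv : ∑ i, v i < 1) {h : (ι → ℝ) → ENNReal}
    (hh : Measurable h) :
    ∫⁻ x, h (subSumSMul v x) = ENNReal.ofReal (1 - ∑ i, v i)⁻¹ * ∫⁻ x, h x := by
  have hdet : 0 < LinearMap.det (subSumSMul v) := by rwa [det_subSumSMul, sub_pos]
  rw [← lintegral_map hh (subSumSMul v).continuous_of_finiteDimensional.measurable,
    Measure.map_linearMap_addHaar_eq_smul_addHaar volume hdet.ne', abs_of_pos (inv_pos.2 hdet),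
    lintegral_smul_measure, det_subSumSMul, smul_eq_mul]

lemma subSumSMul_preimage_posOrthant {v : ι → ℝ} (hv : 0 ≤ v) (hv1 : ∑ i, v i < 1) :
    subSumSMul v ⁻¹' posOrthant ι = {x | ∀ i, v i * ∑ l, x l < x i} ∩ posOrthant ι := by
  ext x
  have hiff : x ∈ subSumSMul v ⁻¹' posOrthant ι ↔ ∀ i, v i * ∑ l, x l < x i := by
    simp only [Set.mem_preimage, posOrthant, Set.mem_ofPred_eq, subSumSMul_apply, sub_pos]
  refine ⟨fun hx => ⟨hiff.1 hx, fun i => lt_of_le_of_lt ?_ (hiff.1 hx i)⟩, fun hx => hiff.2 hx.1⟩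
  have hsum : 0 ≤ (1 - ∑ i, v i) * ∑ l, x l := by
    rw [← sum_subSumSMul]
    exact Finset.sum_nonneg fun i _ => (hx i).le
  exact mul_nonneg (hv i) (nonneg_of_mul_nonneg_right hsum (sub_pos.2 hv1))

lemma measurableSet_forall_mul_sum_lt (v : ι → ℝ) :
    MeasurableSet {x : ι → ℝ | ∀ i, v i * ∑ l, x l < x i} := by
  simp only [Set.ofPred_forall]
  exact MeasurableSet.iInter fun i => measurableSet_lt (by fun_prop) (by fun_prop)

lemma pi_expMeasure_forall_mul_sum_lt_of_sum_lt_one [Nonempty ι] {r : ℝ} (hr : 0 < r) {v : ι → ℝ}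
    (hv : 0 ≤ v) (hv1 : ∑ i, v i < 1) :
    Measure.pi (fun _ : ι => expMeasure r) {x | ∀ i, v i * ∑ l, x l < x i} =
      ENNReal.ofReal ((1 - ∑ i, v i) ^ (Fintype.card ι - 1)) := by
  classical
  have horth := (isOpen_posOrthant (ι := ι)).measurableSet
  set a := 1 - ∑ i, v i
  have ha : 0 < a := sub_pos.2 hv1
  let dens (b : ℝ) (x : ι → ℝ) : ENNReal :=
    ENNReal.ofReal (b ^ Fintype.card ι * Real.exp (-(b * ∑ i, x i)))
  have hdens (b : ℝ) : Measurable (dens b) := by fun_prop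
  have hrescale (x : ι → ℝ) :
      dens r x = ENNReal.ofReal (a ^ Fintype.card ι) * dens (r / a) (subSumSMul v x) := by
    simp only [dens]
    rw [sum_subSumSMul, ← ENNReal.ofReal_mul (by positivity), ← mul_assoc, ← mul_pow,
      mul_div_cancel₀ _ ha.ne', ← mul_assoc, div_mul_cancel₀ _ ha.ne']
  calc Measure.pi (fun _ : ι => expMeasure r) {x | ∀ i, v i * ∑ l, x l < x i}
      = ∫⁻ x in subSumSMul v ⁻¹' posOrthant ι, dens r x := by
        rw [pi_expMeasure_apply hr (measurableSet_forall_mul_sum_lt v),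
          subSumSMul_preimage_posOrthant hv hv1]
    _ = ∫⁻ x, ENNReal.ofReal (a ^ Fintype.card ι) *
          (posOrthant ι).indicator (dens (r / a)) (subSumSMul v x) := by
        rw [← lintegral_indicator
          ((subSumSMul v).continuous_of_finiteDimensional.measurable horth)]
        refine lintegral_congr fun x => ?_
        rw [Set.indicator_apply, Set.indicator_apply, mul_ite, mul_zero, ← hrescale]
        rfl
    _ = ENNReal.ofReal (a ^ Fintype.card ι) * ENNReal.ofReal a⁻¹ := by
        have hmeas := (hdens (r / a)).indicator horth
        rw [lintegral_const_mul' _ _ ENNReal.ofReal_ne_top,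
          lintegral_comp_subSumSMul hv1 hmeas, lintegral_indicator horth,
          setLIntegral_posOrthant_exp_neg_mul_sum (div_pos hr ha), mul_one]
    _ = ENNReal.ofReal (a ^ (Fintype.card ι - 1)) := by
        rw [← ENNReal.ofReal_mul (by positivity), ← pow_sub_one_mul Fintype.card_ne_zero,
          mul_inv_cancel_right₀ ha.ne']

lemma pi_expMeasure_forall_mul_sum_lt_of_one_le_sum {r : ℝ} (hr : 0 < r) {v : ι → ℝ}
    (hv1 : 1 ≤ ∑ i, v i) :
    Measure.pi (fun _ : ι => expMeasure r) {x | ∀ i, v i * ∑ l, x l < x i} = 0 := by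
  have hne : (Finset.univ : Finset ι).Nonempty :=
    Finset.nonempty_of_sum_ne_zero (zero_lt_one.trans_le hv1).ne'
  rw [measure_eq_zero_iff_ae_notMem]
  filter_upwards [ae_mem_posOrthant_pi_expMeasure hr] with x hx hlt
  have hsum : 0 ≤ ∑ i, x i := Finset.sum_nonneg fun i _ => (hx i).le
  have hlt' : (∑ i, v i) * ∑ l, x l < ∑ i, x i := by
    rw [Finset.sum_mul]
    exact Finset.sum_lt_sum_of_nonempty hne fun i _ => hlt i
  exact hlt'.not_ge (le_mul_of_one_le_left hsum hv1)

lemma measureReal_forall_mul_sum_lt [Nontrivial ι] {r : ℝ} (hr : 0 < r) {v : ι → ℝ}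
    (hv : 0 ≤ v) :
    (Measure.pi fun _ : ι => expMeasure r).real {x | ∀ i, v i * ∑ l, x l < x i} =
      max (1 - ∑ i, v i) 0 ^ (Fintype.card ι - 1) := by
  rcases lt_or_ge (∑ i, v i) 1 with hv1 | hv1
  · have ha : 0 ≤ 1 - ∑ i, v i := (sub_pos.2 hv1).le
    rw [measureReal_def, pi_expMeasure_forall_mul_sum_lt_of_sum_lt_one hr hv hv1, max_eq_left ha,
      ENNReal.toReal_ofReal (pow_nonneg ha _)]
  · rw [measureReal_def, pi_expMeasure_forall_mul_sum_lt_of_one_le_sum hr hv1, ENNReal.toReal_zero,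
      max_eq_right (sub_nonpos.2 hv1), zero_pow (Nat.sub_ne_zero_of_lt Fintype.one_lt_card)]

lemma measureReal_forall_mem_mul_sum_lt [Nontrivial ι] {r : ℝ} (hr : 0 < r) {k : ℝ} (hk : 0 ≤ k)
    (J : Finset ι) :
    (Measure.pi fun _ : ι => expMeasure r).real {x | ∀ i ∈ J, k * ∑ l, x l < x i} =
      max (1 - J.card * k) 0 ^ (Fintype.card ι - 1) := by
  classical
  let v (i : ι) : ℝ := if i ∈ J then k else 0
  have hv : 0 ≤ v := fun i => by by_cases hi : i ∈ J <;> simp [v, hi, hk]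
  have hsum : ∑ i, v i = J.card * k := by simp [v]
  rw [← hsum, ← measureReal_forall_mul_sum_lt hr hv]
  refine measureReal_congr ?_
  filter_upwards [ae_mem_posOrthant_pi_expMeasure hr] with x hx
  refine propext (forall_congr' fun i => ?_)
  by_cases hi : i ∈ J
  · simp [v, hi]
  · simp [v, hi, hx i]

/-- **Fisher's formula** for the largest spacing. -/
theorem measureReal_exists_mul_sum_lt [Nontrivial ι] {r : ℝ} (hr : 0 < r) {k : ℝ} (hk : 0 ≤ k) :
    (Measure.pi fun _ : ι => expMeasure r).real {x | ∃ i, k * ∑ l, x l < x i} =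
      fisherTail (Fintype.card ι) k := by
  have : IsProbabilityMeasure (expMeasure r) := isProbabilityMeasure_expMeasure hr
  have hunion : {x : ι → ℝ | ∃ i, k * ∑ l, x l < x i} =
      ⋃ i ∈ (Finset.univ : Finset ι), {x | k * ∑ l, x l < x i} := by ext; simp
  have hinter (J : Finset ι) : ⋂ i ∈ J, {x : ι → ℝ | k * ∑ l, x l < x i} =
      {x | ∀ i ∈ J, k * ∑ l, x l < x i} := by ext; simp
  let summand (j : ℕ) : ℝ := (-1) ^ (j + 1) * max (1 - j * k) 0 ^ (Fintype.card ι - 1)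
  calc (Measure.pi fun _ : ι => expMeasure r).real {x | ∃ i, k * ∑ l, x l < x i}
      = ∑ J : Finset ι with J.Nonempty, summand J.card := by
        rw [hunion, measureReal_biUnion_eq_sum_powerset
          fun i _ => measurableSet_lt (by fun_prop) (by fun_prop)]
        simp only [hinter, measureReal_forall_mem_mul_sum_lt hr hk, Finset.powerset_univ, summand]
    _ = ∑ J : Finset ι, if J.card = 0 then 0 else summand J.card := by
        simp only [Finset.sum_filter, Finset.card_eq_zero, ← Finset.not_nonempty_iff_eq_empty,
          ite_not]
    _ = ∑ j ∈ Finset.range (Fintype.card ι + 1),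
          (Fintype.card ι).choose j • if j = 0 then 0 else summand j := by
        rw [← Finset.powerset_univ, Finset.sum_powerset_apply_card fun j => if j = 0 then 0 else
          summand j, Finset.card_univ]
    _ = fisherTail (Fintype.card ι) k := by
        rw [fisherTail, Finset.range_eq_Ico, Finset.sum_eq_sum_Ico_succ_bot (Nat.succ_pos _)]
        simp only [if_true, smul_zero, zero_add]
        refine Finset.sum_congr (by ext; simp) fun j hj => ?_
        rw [if_neg (Nat.one_le_iff_ne_zero.1 (Finset.mem_Icc.1 hj).1), nsmul_eq_mul,
          mul_left_comm, mul_assoc]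

end Exponential

lemma sum_neg_one_pow_mul_choose_mul_eval_eq_zero {R : Type*} [CommRing R] {P : Polynomial R}
    {n : ℕ} (hP : P.natDegree < n) :
    ∑ i ∈ Finset.range (n + 1), (-1) ^ i * (n.choose i : R) * P.eval (i : R) = 0 := by
  have hdiff := fwdDiff_iter_eq_sum_shift (1 : R) P.eval n 0
  rw [Polynomial.fwdDiff_iter_eq_zero_of_degree_lt hP, Pi.zero_apply] at hdiff
  rw [← mul_zero ((-1) ^ n), hdiff, Finset.mul_sum]
  refine Finset.sum_congr rfl fun i hi => ?_
  have hsign : (-1 : R) ^ n * (-1) ^ (n - i) = (-1) ^ i := by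
    rw [← pow_sub_mul_pow (-1 : R) (Finset.mem_range_succ_iff.1 hi), mul_right_comm, ← mul_pow,
      neg_one_mul, neg_neg, one_pow, one_mul]
  rw [zero_add, nsmul_one, zsmul_eq_mul, ← hsign]
  push_cast
  ring

lemma continuous_fisherTail (q : ℕ) : Continuous (fisherTail q) := by
  unfold fisherTail
  fun_prop

lemma fisherTail_one (k : ℝ) : fisherTail 1 k = 1 := by
  simp [fisherTail]

lemma fisherTail_of_one_le {q : ℕ} (hq : 2 ≤ q) {k : ℝ} (hk : 1 ≤ k) : fisherTail q k = 0 := by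
  refine Finset.sum_eq_zero fun j hj => ?_
  have hj : (1 : ℝ) ≤ j := by exact_mod_cast (Finset.mem_Icc.1 hj).1
  rw [max_eq_right (sub_nonpos.2 (one_le_mul_of_one_le_of_one_le hj hk)), zero_pow (by omega),
    mul_zero]

lemma fisherTail_of_le_inv {q : ℕ} (hq : 1 ≤ q) {k : ℝ} (hk : k ≤ (q : ℝ)⁻¹) :
    fisherTail q k = 1 := by
  have hqk : q * k ≤ 1 := (le_inv_mul_iff₀ (by positivity)).1 (by rwa [mul_one])
  have hnonneg {j : ℕ} (hj : j ≤ q) : 0 ≤ 1 - j * k := by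
    have hj : (j : ℝ) ≤ q := by exact_mod_cast hj
    rcases le_total k 0 with hk0 | hk0 <;> nlinarith
  let P : Polynomial ℝ := (1 - Polynomial.C k * Polynomial.X) ^ (q - 1)
  have hlin : (1 - Polynomial.C k * Polynomial.X).natDegree ≤ 1 := by compute_degree
  have hdeg : P.natDegree < q :=
    (Polynomial.natDegree_pow_le_of_le (q - 1) hlin).trans_lt (by omega)
  have hsum := sum_neg_one_pow_mul_choose_mul_eval_eq_zero hdeg
  rw [Finset.range_eq_Ico, Finset.sum_eq_sum_Ico_succ_bot (Nat.succ_pos _)] at hsum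
  have heval (j : ℕ) : P.eval (j : ℝ) = (1 - j * k) ^ (q - 1) := by
    simp only [P, Polynomial.eval_pow, Polynomial.eval_sub, Polynomial.eval_one,
      Polynomial.eval_mul, Polynomial.eval_C, Polynomial.eval_X, mul_comm k]
  have htail : fisherTail q k =
      -∑ j ∈ Finset.Ico 1 (q + 1), (-1) ^ j * (q.choose j : ℝ) * P.eval (j : ℝ) := by
    rw [fisherTail, ← Finset.sum_neg_distrib]
    refine Finset.sum_congr (by ext; simp) fun j hj => ?_
    rw [max_eq_left (hnonneg (Finset.mem_Icc.1 hj).2), heval, pow_succ]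
    ring
  have hzero : (-1 : ℝ) ^ 0 * (q.choose 0 : ℝ) * P.eval ((0 : ℕ) : ℝ) = 1 := by
    rw [heval]
    simp
  rw [hzero, zero_add] at hsum
  rw [htail]
  linarith

lemma exists_mem_posOrthant_max_mem_Ioo {ι : Type*} [Fintype ι] [Nontrivial ι] {k k' : ℝ}
    (hk : (Fintype.card ι : ℝ)⁻¹ ≤ k) (hkk' : k < k') (hk' : k' ≤ 1) :
    ∃ x ∈ posOrthant ι, (∃ i, k * ∑ l, x l < x i) ∧ ∀ i, x i < k' * ∑ l, x l := by
  classical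
  have hcard : (1 : ℝ) < Fintype.card ι := by exact_mod_cast Fintype.one_lt_card
  obtain ⟨t, hkt, htk'⟩ := exists_between hkk'
  have hct : 1 < Fintype.card ι * t := by
    have := (inv_le_iff_one_le_mul₀' (by linarith)).1 hk
    nlinarith
  obtain ⟨i₀⟩ : Nonempty ι := inferInstance
  let c : ℝ := (1 - t) / (Fintype.card ι - 1)
  have hc : 0 < c := div_pos (by linarith) (by linarith)
  have hct : c < t := by
    rw [div_lt_iff₀ (by linarith)]
    linarith
  let x (i : ι) : ℝ := c + if i = i₀ then t - c else 0
  have hsum : ∑ i, x i = 1 := by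
    have : (Fintype.card ι - 1) * c = 1 - t := mul_div_cancel₀ _ (by linarith)
    simp only [x, Finset.sum_add_distrib, Finset.sum_const, Finset.card_univ, nsmul_eq_mul,
      Finset.sum_ite_eq', Finset.mem_univ, if_true]
    linarith
  refine ⟨x, fun i => ?_, ⟨i₀, ?_⟩, fun i => ?_⟩
  · by_cases hi : i = i₀ <;> simp [x, hi] <;> linarith
  · simpa [hsum, x] using hkt
  · by_cases hi : i = i₀ <;> simp [hsum, x, hi] <;> linarith

lemma isOpen_exists_mul_sum_lt {ι : Type*} [Fintype ι] (k : ℝ) :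
    IsOpen {x : ι → ℝ | ∃ i, k * ∑ l, x l < x i} := by
  simp only [Set.ofPred_exists]
  exact isOpen_iUnion fun i => isOpen_lt (by fun_prop) (by fun_prop)

lemma isOpen_forall_lt_mul_sum {ι : Type*} [Fintype ι] (k : ℝ) :
    IsOpen {x : ι → ℝ | ∀ i, x i < k * ∑ l, x l} := by
  simp only [Set.ofPred_forall]
  exact isOpen_iInter_of_finite fun i => isOpen_lt (by fun_prop) (by fun_prop)

lemma strictAntiOn_measureReal_exists_mul_sum_lt {ι : Type*} [Fintype ι] [Nontrivial ι] {r : ℝ}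
    (hr : 0 < r) :
    StrictAntiOn (fun k : ℝ =>
        (Measure.pi fun _ : ι => expMeasure r).real {x | ∃ i, k * ∑ l, x l < x i})
      (Set.Icc (Fintype.card ι : ℝ)⁻¹ 1) := by
  rintro k ⟨hk, -⟩ k' ⟨-, hk'⟩ hkk'
  have : IsProbabilityMeasure (expMeasure r) := isProbabilityMeasure_expMeasure hr
  set μ := Measure.pi fun _ : ι => expMeasure r
  let exceeds (t : ℝ) : Set (ι → ℝ) := {x | ∃ i, t * ∑ l, x l < x i}
  let between : Set (ι → ℝ) := exceeds k ∩ {x | ∀ i, x i < k' * ∑ l, x l}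
  have hbetween : IsOpen between := (isOpen_exists_mul_sum_lt k).inter (isOpen_forall_lt_mul_sum k')
  have hpos : 0 < μ.real between := by
    obtain ⟨x, hx, hlt, hgt⟩ := exists_mem_posOrthant_max_mem_Ioo hk hkk' hk'
    exact ENNReal.toReal_pos (pi_expMeasure_pos_of_isOpen hr hbetween ⟨x, ⟨hlt, hgt⟩, hx⟩).ne'
      (measure_ne_top _ _)
  have hdisj : Disjoint (exceeds k') between :=
    Set.disjoint_left.2 fun x ⟨i, hi⟩ hx => (hx.2 i).not_gt hi
  have hsub : ∀ᵐ x ∂μ, x ∈ exceeds k' ∪ between → x ∈ exceeds k := by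
    filter_upwards [ae_mem_posOrthant_pi_expMeasure hr] with x hx
    rintro (⟨i, hi⟩ | hx')
    · have hsum : 0 ≤ ∑ l, x l := Finset.sum_nonneg fun i _ => (hx i).le
      exact ⟨i, (mul_le_mul_of_nonneg_right hkk'.le hsum).trans_lt hi⟩
    · exact hx'.1
  calc μ.real (exceeds k') < μ.real (exceeds k') + μ.real between := lt_add_of_pos_right _ hpos
    _ = μ.real (exceeds k' ∪ between) := (measureReal_union hdisj hbetween.measurableSet).symm
    _ ≤ μ.real (exceeds k) := ENNReal.toReal_mono (measure_ne_top _ _) (measure_mono_ae hsub)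

lemma strictAntiOn_fisherTail {q : ℕ} (hq : 2 ≤ q) :
    StrictAntiOn (fisherTail q) (Set.Icc (q : ℝ)⁻¹ 1) := by
  have : Nontrivial (Fin q) := Fin.nontrivial_iff_two_le.2 hq
  have hanti := strictAntiOn_measureReal_exists_mul_sum_lt (ι := Fin q) one_pos
  rw [Fintype.card_fin] at hanti
  refine hanti.congr fun k hk => ?_
  have hk0 : 0 ≤ k := le_trans (by positivity) hk.1
  exact (measureReal_exists_mul_sum_lt one_pos hk0).trans (by rw [Fintype.card_fin])

lemma mem_Ioo_of_fisherTail_mem_Ioo {q : ℕ} (hq : 2 ≤ q) {k : ℝ}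
    (hk : fisherTail q k ∈ Set.Ioo 0 1) : k ∈ Set.Ioo (q : ℝ)⁻¹ 1 :=
  ⟨lt_of_not_ge fun h => hk.2.ne (fisherTail_of_le_inv (by omega) h),
    lt_of_not_ge fun h => hk.1.ne' (fisherTail_of_one_le hq h)⟩

theorem existsUnique_fisherTail_eq {q : ℕ} (hq : 2 ≤ q) {α : ℝ} (hα : α ∈ Set.Ioo 0 1) :
    ∃! k : ℝ, fisherTail q k = α := by
  have hle : (q : ℝ)⁻¹ ≤ 1 := Nat.cast_inv_le_one q
  have hivt := intermediate_value_Icc' hle (continuous_fisherTail q).continuousOn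
  rw [fisherTail_of_le_inv (by omega) le_rfl, fisherTail_of_one_le hq le_rfl] at hivt
  obtain ⟨k, hk, hkα⟩ := hivt (Set.Ioo_subset_Icc_self hα)
  refine ⟨k, hkα, fun l hl => (strictAntiOn_fisherTail hq).injOn ?_ hk (hl.trans hkα.symm)⟩
  exact Set.Ioo_subset_Icc_self (mem_Ioo_of_fisherTail_mem_Ioo hq (hl ▸ hα))

section Gaussian

variable {ι κ τ : Type*} [Fintype ι] [Fintype κ] [Fintype τ]

lemma hasLaw_eval_pi_gaussianReal (i : ι) :
    HasLaw (fun x : ι → ℝ => x i) (gaussianReal 0 1) (Measure.pi fun _ => gaussianReal 0 1) :=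
  (measurePreserving_eval (fun _ : ι => gaussianReal 0 1) i).hasLaw

lemma iIndepFun_eval_pi_gaussianReal :
    iIndepFun (fun (i : ι) (x : ι → ℝ) => x i) (Measure.pi fun _ => gaussianReal 0 1) :=
  iIndepFun_pi (X := fun _ x => x) fun _ => aemeasurable_id

lemma hasGaussianLaw_id_pi_gaussianReal :
    HasGaussianLaw (fun x : ι → ℝ => x) (Measure.pi fun _ => gaussianReal 0 1) :=
  iIndepFun_eval_pi_gaussianReal.hasGaussianLaw fun i =>
    (hasLaw_eval_pi_gaussianReal i).hasGaussianLaw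

lemma covariance_dotProduct_pi_gaussianReal (v w : ι → ℝ) :
    cov[fun x => v ⬝ᵥ x, fun x => w ⬝ᵥ x; Measure.pi fun _ => gaussianReal 0 1] = v ⬝ᵥ w := by
  classical
  have hcov (i j : ι) : cov[fun x => x i, fun x => x j; Measure.pi fun _ => gaussianReal 0 1] =
      if i = j then 1 else 0 := by
    split_ifs with h
    · subst h
      rw [covariance_self (measurable_pi_apply i).aemeasurable,
        (hasLaw_eval_pi_gaussianReal i).variance_eq, variance_id_gaussianReal, NNReal.coe_one]
    · exact (iIndepFun_eval_pi_gaussianReal.indepFun h).covariance_eq_zero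
        (hasLaw_eval_pi_gaussianReal i).hasGaussianLaw.memLp_two
        (hasLaw_eval_pi_gaussianReal j).hasGaussianLaw.memLp_two
  have hmem (c : ℝ) (i : ι) :
      MemLp (fun x : ι → ℝ => c * x i) 2 (Measure.pi fun _ => gaussianReal 0 1) :=
    (hasLaw_eval_pi_gaussianReal i).hasGaussianLaw.memLp_two.const_mul c
  rw [dotProduct_comm v w]
  simp only [dotProduct]
  rw [covariance_fun_sum_fun_sum (fun i => hmem _ i) (fun i => hmem _ i)]
  simp only [covariance_const_mul_left, covariance_const_mul_right, hcov, mul_ite, mul_one,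
    mul_zero, Finset.sum_ite_eq, Finset.mem_univ, if_true]

lemma integral_dotProduct_pi_gaussianReal (v : ι → ℝ) :
    ∫ x, v ⬝ᵥ x ∂(Measure.pi fun _ => gaussianReal 0 1) = 0 := by
  simp only [dotProduct]
  rw [integral_finsetSum _ fun i _ =>
    (hasLaw_eval_pi_gaussianReal i).hasGaussianLaw.integrable.const_mul _]
  refine Finset.sum_eq_zero fun i _ => ?_
  rw [integral_const_mul, (hasLaw_eval_pi_gaussianReal i).integral_eq, integral_id_gaussianReal,
    mul_zero]

lemma map_mulVec_pi_gaussianReal [DecidableEq τ] {W : Matrix τ ι ℝ} {v : NNReal}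
    (hW : W * W.transpose = (v : ℝ) • 1) :
    (Measure.pi fun _ => gaussianReal 0 1).map (fun x => W.mulVec x) =
      Measure.pi fun _ => gaussianReal 0 v := by
  have hcov (s t : τ) : cov[fun x => W.mulVec x s, fun x => W.mulVec x t;
      Measure.pi fun _ => gaussianReal 0 1] = if s = t then (v : ℝ) else 0 := by
    refine (covariance_dotProduct_pi_gaussianReal (W s) (W t)).trans ((congrFun₂ hW s t).trans ?_)
    rw [Matrix.smul_apply, Matrix.one_apply, smul_eq_mul, mul_ite, mul_one, mul_zero]
  have hgauss : HasGaussianLaw (fun x => W.mulVec x) (Measure.pi fun _ => gaussianReal 0 1) :=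
    hasGaussianLaw_id_pi_gaussianReal.map_fun W.mulVecLin.toContinuousLinearMap
  have hlaw (t : τ) : (Measure.pi fun _ => gaussianReal 0 1).map (fun x => W.mulVec x t) =
      gaussianReal 0 v := by
    rw [(hgauss.eval t).map_eq_gaussianReal, ← covariance_self (hgauss.eval t).aemeasurable, hcov,
      if_pos rfl, Real.toNNReal_coe]
    exact congrArg (gaussianReal · v) (integral_dotProduct_pi_gaussianReal (W t))
  have hind := hgauss.iIndepFun_of_covariance_eq_zero fun s t hst => (hcov s t).trans (if_neg hst)
  rw [(iIndepFun_iff_map_fun_eq_pi_map fun t => (hgauss.eval t).aemeasurable).1 hind]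
  simp only [hlaw]

lemma map_sq_add_sq_pi_gaussianReal {v : NNReal} (hv : v ≠ 0) :
    (Measure.pi fun _ : κ ⊕ κ => gaussianReal 0 v).map
        (fun y i => y (.inl i) ^ 2 + y (.inr i) ^ 2) =
      Measure.pi fun _ : κ => expMeasure (2 * v : ℝ)⁻¹ := by
  have hpair := (measurePreserving_arrowProdEquivProdArrow ℝ ℝ κ (fun _ => gaussianReal 0 v)
    fun _ => gaussianReal 0 v).symm.comp
      (measurePreserving_sumPiEquivProdPi fun _ : κ ⊕ κ => gaussianReal 0 v)
  have hsq : Measurable fun p : ℝ × ℝ => p.1 ^ 2 + p.2 ^ 2 := by fun_prop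
  have := Measure.isProbabilityMeasure_map (μ := (gaussianReal 0 v).prod (gaussianReal 0 v))
    hsq.aemeasurable
  rw [← map_sq_add_sq_gaussianReal hv, ← Measure.pi_map_pi fun _ => hsq.aemeasurable,
    ← hpair.map_eq, Measure.map_map (by fun_prop) hpair.measurable]
  rfl

lemma map_mulVec_sq_add_mulVec_sq_pi_gaussianReal [DecidableEq κ] {C S : Matrix κ ι ℝ} {v : NNReal}
    (hv : v ≠ 0) (hC : C * C.transpose = (v : ℝ) • 1) (hS : S * S.transpose = (v : ℝ) • 1)
    (hCS : C * S.transpose = 0) :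
    (Measure.pi fun _ => gaussianReal 0 1).map
        (fun x i => C.mulVec x i ^ 2 + S.mulVec x i ^ 2) =
      Measure.pi fun _ : κ => expMeasure (2 * v : ℝ)⁻¹ := by
  have hgram : C.fromRows S * (C.fromRows S).transpose = (v : ℝ) • 1 := by
    have hSC : S * C.transpose = 0 := by
      rw [← Matrix.transpose_transpose S, ← Matrix.transpose_mul, hCS, Matrix.transpose_zero]
    rw [Matrix.transpose_fromRows, Matrix.fromRows_mul_fromCols, hC, hS, hCS, hSC,
      ← Matrix.fromBlocks_one, Matrix.fromBlocks_smul, smul_zero]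
  rw [← map_sq_add_sq_pi_gaussianReal hv, ← map_mulVec_pi_gaussianReal hgram,
    Measure.map_map (by fun_prop) (by fun_prop)]
  rfl

end Gaussian

section Trigonometric

variable {d : ℕ}

lemma sum_cexp_succ_mul_two_pi_mul_div [NeZero d] (a : ℤ) :
    ∑ l : Fin d, Complex.exp (((((l : ℕ) + 1 : ℕ) * (2 * Real.pi * a / d) : ℝ) : ℂ) *
      Complex.I) = if (d : ℤ) ∣ a then (d : ℂ) else 0 := by
  set ζ := Complex.exp (2 * Real.pi * Complex.I / d)
  have hζ : IsPrimitiveRoot ζ d := Complex.isPrimitiveRoot_exp d (NeZero.ne d)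
  have hterm (l : Fin d) : Complex.exp (((((l : ℕ) + 1 : ℕ) * (2 * Real.pi * a / d) : ℝ) : ℂ) *
      Complex.I) = ζ ^ a * (ζ ^ a) ^ (l : ℕ) := by
    rw [← pow_succ', ← Complex.exp_int_mul, ← Complex.exp_nat_mul]
    congr 1
    push_cast
    ring
  simp only [hterm, ← Finset.mul_sum, Fin.sum_univ_eq_sum_range fun l => (ζ ^ a) ^ l]
  split_ifs with ha
  · simp [(hζ.zpow_eq_one_iff_dvd a).2 ha]
  · have hpow : (ζ ^ a) ^ d = 1 := by
      rw [← zpow_natCast, zpow_comm, zpow_natCast, hζ.pow_eq_one, one_zpow]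
    rw [geom_sum_eq (mt (hζ.zpow_eq_one_iff_dvd a).1 ha), hpow, sub_self, zero_div, mul_zero]

lemma sum_cos_succ_mul_two_pi_mul_div [NeZero d] (a : ℤ) :
    ∑ l : Fin d, Real.cos (((l : ℕ) + 1 : ℕ) * (2 * Real.pi * a / d)) =
      if (d : ℤ) ∣ a then (d : ℝ) else 0 := by
  have hre := congrArg Complex.re (sum_cexp_succ_mul_two_pi_mul_div (d := d) a)
  simpa only [Complex.re_sum, Complex.exp_ofReal_mul_I_re, apply_ite Complex.re,
    Complex.natCast_re, Complex.zero_re] using hre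

lemma sum_sin_succ_mul_two_pi_mul_div [NeZero d] (a : ℤ) :
    ∑ l : Fin d, Real.sin (((l : ℕ) + 1 : ℕ) * (2 * Real.pi * a / d)) = 0 := by
  have him := congrArg Complex.im (sum_cexp_succ_mul_two_pi_mul_div (d := d) a)
  simpa only [Complex.im_sum, Complex.exp_ofReal_mul_I_im, apply_ite Complex.im,
    Complex.natCast_im, Complex.zero_im, ite_self] using him

lemma succ_mul_fourierFreq_sub (l : Fin d) (j k : ℕ) :
    ((l : ℕ) + 1 : ℕ) * fourierFreq d j - ((l : ℕ) + 1 : ℕ) * fourierFreq d k =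
      ((l : ℕ) + 1 : ℕ) * (2 * Real.pi * (j - k : ℤ) / d) := by
  simp only [fourierFreq]
  push_cast
  ring

lemma succ_mul_fourierFreq_add (l : Fin d) (j k : ℕ) :
    ((l : ℕ) + 1 : ℕ) * fourierFreq d j + ((l : ℕ) + 1 : ℕ) * fourierFreq d k =
      ((l : ℕ) + 1 : ℕ) * (2 * Real.pi * (j + k : ℤ) / d) := by
  simp only [fourierFreq]
  push_cast
  ring

lemma sum_cos_fourierFreq_mul_cos_fourierFreq [NeZero d] (j k : ℕ) :
    ∑ l : Fin d, Real.cos (((l : ℕ) + 1 : ℕ) * fourierFreq d j) *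
        Real.cos (((l : ℕ) + 1 : ℕ) * fourierFreq d k) =
      ((if (d : ℤ) ∣ j - k then (d : ℝ) else 0) + if (d : ℤ) ∣ j + k then (d : ℝ) else 0) / 2 := by
  rw [eq_div_iff two_ne_zero, ← sum_cos_succ_mul_two_pi_mul_div, ← sum_cos_succ_mul_two_pi_mul_div,
    Finset.sum_mul, ← Finset.sum_add_distrib]
  refine Finset.sum_congr rfl fun l _ => ?_
  rw [← succ_mul_fourierFreq_sub, ← succ_mul_fourierFreq_add, ← Real.two_mul_cos_mul_cos]
  ring

lemma sum_sin_fourierFreq_mul_sin_fourierFreq [NeZero d] (j k : ℕ) :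
    ∑ l : Fin d, Real.sin (((l : ℕ) + 1 : ℕ) * fourierFreq d j) *
        Real.sin (((l : ℕ) + 1 : ℕ) * fourierFreq d k) =
      ((if (d : ℤ) ∣ j - k then (d : ℝ) else 0) - if (d : ℤ) ∣ j + k then (d : ℝ) else 0) / 2 := by
  rw [eq_div_iff two_ne_zero, ← sum_cos_succ_mul_two_pi_mul_div, ← sum_cos_succ_mul_two_pi_mul_div,
    Finset.sum_mul, ← Finset.sum_sub_distrib]
  refine Finset.sum_congr rfl fun l _ => ?_
  rw [← succ_mul_fourierFreq_sub, ← succ_mul_fourierFreq_add, ← Real.two_mul_sin_mul_sin]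
  ring

lemma sum_cos_fourierFreq_mul_sin_fourierFreq [NeZero d] (j k : ℕ) :
    ∑ l : Fin d, Real.cos (((l : ℕ) + 1 : ℕ) * fourierFreq d j) *
      Real.sin (((l : ℕ) + 1 : ℕ) * fourierFreq d k) = 0 := by
  have hsum := congrArg₂ (· - ·) (sum_sin_succ_mul_two_pi_mul_div (d := d) (j + k))
    (sum_sin_succ_mul_two_pi_mul_div (d := d) (j - k))
  simp only [← Finset.sum_sub_distrib, ← succ_mul_fourierFreq_sub, ← succ_mul_fourierFreq_add,
    Real.sin_add, Real.sin_sub, sub_zero] at hsum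
  rw [← mul_eq_zero_iff_left (two_ne_zero (α := ℝ)), Finset.mul_sum, ← hsum]
  exact Finset.sum_congr rfl fun l _ => by ring

lemma two_mul_lt_of_mem_Icc_numFreq {j : ℕ} (hj : j ∈ Finset.Icc 1 (numFreq d)) : 2 * j < d := by
  rw [Finset.mem_Icc, numFreq] at hj
  omega

lemma natCast_dvd_sub_iff {j k : ℕ} (hj : j ∈ Finset.Icc 1 (numFreq d))
    (hk : k ∈ Finset.Icc 1 (numFreq d)) : (d : ℤ) ∣ j - k ↔ j = k := by
  have hjd := two_mul_lt_of_mem_Icc_numFreq hj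
  have hkd := two_mul_lt_of_mem_Icc_numFreq hk
  refine ⟨fun h => ?_, fun h => by rw [h, sub_self]; exact dvd_zero _⟩
  have := Int.eq_zero_of_abs_lt_dvd h (by rw [abs_lt]; constructor <;> omega)
  omega

lemma not_natCast_dvd_add {j k : ℕ} (hj : j ∈ Finset.Icc 1 (numFreq d))
    (hk : k ∈ Finset.Icc 1 (numFreq d)) : ¬ (d : ℤ) ∣ j + k := fun h => by
  have hjd := two_mul_lt_of_mem_Icc_numFreq hj
  have hkd := two_mul_lt_of_mem_Icc_numFreq hk
  have hpos := (Finset.mem_Icc.1 hj).1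
  have := Int.le_of_dvd (by omega) h
  omega

lemma not_natCast_dvd {j : ℕ} (hj : j ∈ Finset.Icc 1 (numFreq d)) : ¬ (d : ℤ) ∣ j := fun h =>
  not_natCast_dvd_add hj hj (h.add h)

/-- The cosine vectors of the Fourier frequencies `1, …, q`, as rows of a matrix. The factor
`(√d)⁻¹` makes the periodogram a sum of two squares, see
`periodogram_eq_cosMatrix_sq_add_sinMatrix_sq`. -/
noncomputable def cosMatrix (d : ℕ) : Matrix (Finset.Icc 1 (numFreq d)) (Fin d) ℝ :=
  .of fun j l => (√d)⁻¹ * Real.cos (((l : ℕ) + 1 : ℕ) * fourierFreq d j)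

/-- The sine vectors of the Fourier frequencies, normalized as in `cosMatrix`. -/
noncomputable def sinMatrix (d : ℕ) : Matrix (Finset.Icc 1 (numFreq d)) (Fin d) ℝ :=
  .of fun j l => (√d)⁻¹ * Real.sin (((l : ℕ) + 1 : ℕ) * fourierFreq d j)

lemma sum_inv_sqrt_mul_mul (u w : Fin d → ℝ) :
    ∑ l, (√d)⁻¹ * u l * ((√d)⁻¹ * w l) = (d : ℝ)⁻¹ * ∑ l, u l * w l := by
  simp only [mul_mul_mul_comm _ (u _), ← mul_inv, Real.mul_self_sqrt (Nat.cast_nonneg d),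
    Finset.mul_sum]

lemma cosMatrix_mul_transpose [NeZero d] :
    cosMatrix d * (cosMatrix d).transpose = (2⁻¹ : ℝ) • 1 := by
  ext j k
  rw [Matrix.mul_apply, Matrix.smul_apply, Matrix.one_apply]
  simp only [cosMatrix, Matrix.transpose_apply, Matrix.of_apply, sum_inv_sqrt_mul_mul,
    sum_cos_fourierFreq_mul_cos_fourierFreq, natCast_dvd_sub_iff j.2 k.2,
    not_natCast_dvd_add j.2 k.2, if_false, add_zero, Subtype.ext_iff]
  have := NeZero.ne (d : ℝ)
  split_ifs <;> simp [field]

lemma sinMatrix_mul_transpose [NeZero d] :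
    sinMatrix d * (sinMatrix d).transpose = (2⁻¹ : ℝ) • 1 := by
  ext j k
  rw [Matrix.mul_apply, Matrix.smul_apply, Matrix.one_apply]
  simp only [sinMatrix, Matrix.transpose_apply, Matrix.of_apply, sum_inv_sqrt_mul_mul,
    sum_sin_fourierFreq_mul_sin_fourierFreq, natCast_dvd_sub_iff j.2 k.2,
    not_natCast_dvd_add j.2 k.2, if_false, sub_zero, Subtype.ext_iff]
  have := NeZero.ne (d : ℝ)
  split_ifs <;> simp [field]

lemma cosMatrix_mul_sinMatrix_transpose [NeZero d] :
    cosMatrix d * (sinMatrix d).transpose = 0 := by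
  ext j k
  rw [Matrix.mul_apply, Matrix.zero_apply]
  simp only [cosMatrix, sinMatrix, Matrix.transpose_apply, Matrix.of_apply, sum_inv_sqrt_mul_mul,
    sum_cos_fourierFreq_mul_sin_fourierFreq, mul_zero]

lemma cexp_neg_I_mul_fourierFreq (l : Fin d) (j : ℕ) :
    Complex.exp (-Complex.I * (((l : ℕ) + 1 : ℕ) : ℂ) * (fourierFreq d j : ℂ)) =
      Complex.exp (((-(((l : ℕ) + 1 : ℕ) * fourierFreq d j) : ℝ) : ℂ) * Complex.I) := by
  congr 1
  push_cast
  ring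

lemma periodogram_eq_cosMatrix_sq_add_sinMatrix_sq (x : Fin d → ℝ)
    (j : Finset.Icc 1 (numFreq d)) :
    periodogram x j = (cosMatrix d).mulVec x j ^ 2 + (sinMatrix d).mulVec x j ^ 2 := by
  have hpull (u : Fin d → ℝ) : (∑ l, (√d)⁻¹ * u l * x l) ^ 2 = 1 / d * (∑ l, x l * u l) ^ 2 := by
    rw [one_div, ← Real.sq_sqrt (Nat.cast_nonneg d), ← inv_pow, ← mul_pow, Finset.mul_sum,
      Real.sqrt_sq (Real.sqrt_nonneg _)]
    simp only [mul_assoc, mul_comm (u _)]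
  simp only [periodogram, cexp_neg_I_mul_fourierFreq, Matrix.mulVec, dotProduct, cosMatrix,
    sinMatrix, Matrix.of_apply, hpull, ← mul_add]
  rw [Complex.sq_norm, Complex.normSq_apply, Complex.re_sum, Complex.im_sum]
  simp only [Complex.re_ofReal_mul, Complex.im_ofReal_mul, Complex.exp_ofReal_mul_I_re,
    Complex.exp_ofReal_mul_I_im, Real.cos_neg, Real.sin_neg, mul_neg, Finset.sum_neg_distrib,
    ← sq, even_two.neg_pow]

lemma map_periodogram_pi_gaussianReal [NeZero d] :
    (Measure.pi fun _ => gaussianReal 0 1).map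
        (fun (x : Fin d → ℝ) (j : Finset.Icc 1 (numFreq d)) => periodogram x j) =
      Measure.pi fun _ => expMeasure 1 := by
  have hmap := map_mulVec_sq_add_mulVec_sq_pi_gaussianReal (inv_ne_zero two_ne_zero)
    (by simpa using cosMatrix_mul_transpose (d := d))
    (by simpa using sinMatrix_mul_transpose (d := d)) cosMatrix_mul_sinMatrix_transpose
  simpa [← periodogram_eq_cosMatrix_sq_add_sinMatrix_sq] using hmap

end Trigonometric

section FisherStatistic

variable {d : ℕ}

lemma periodogram_nonneg (x : Fin d → ℝ) (j : ℕ) : 0 ≤ periodogram x j := by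
  unfold periodogram
  positivity

lemma continuous_periodogram (j : ℕ) : Continuous fun x : Fin d → ℝ => periodogram x j := by
  unfold periodogram
  fun_prop

lemma isClosed_degenerateSet : IsClosed (degenerateSet d) := by
  simp only [degenerateSet, Set.ofPred_forall]
  exact isClosed_biInter fun j _ => isClosed_eq (continuous_periodogram j) continuous_const

lemma sum_periodogram_pos {x : Fin d → ℝ} (hx : x ∉ degenerateSet d) :
    0 < ∑ m ∈ Finset.Icc 1 (numFreq d), periodogram x m := by
  simp only [degenerateSet, Set.mem_ofPred_eq, not_forall] at hx
  obtain ⟨j, hj, hne⟩ := hx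
  exact Finset.sum_pos' (fun i _ => periodogram_nonneg x i)
    ⟨j, hj, (periodogram_nonneg x j).lt_of_ne' hne⟩

lemma continuous_iSup_periodogram :
    Continuous fun x : Fin d → ℝ => ⨆ j : Finset.Icc 1 (numFreq d), periodogram x j := by
  cases isEmpty_or_nonempty (Finset.Icc 1 (numFreq d))
  · simp only [Real.iSup_of_isEmpty, continuous_const]
  · simp only [← Finset.sup'_univ_eq_ciSup]
    exact Continuous.finset_sup'_apply _ fun j _ => continuous_periodogram j

lemma continuous_sum_periodogram :
    Continuous fun x : Fin d → ℝ => ∑ m ∈ Finset.Icc 1 (numFreq d), periodogram x m :=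
  continuous_finsetSum _ fun j _ => continuous_periodogram j

lemma measurable_fisherG : Measurable (fisherG (d := d)) :=
  continuous_iSup_periodogram.measurable.div continuous_sum_periodogram.measurable

lemma measurable_fisherF : Measurable (fisherF (d := d)) :=
  measurable_fisherG.indicator isClosed_degenerateSet.measurableSet.compl

lemma fisherF_of_mem {x : Fin d → ℝ} (hx : x ∈ degenerateSet d) : fisherF x = 0 :=
  Set.indicator_of_notMem (Set.notMem_compl_iff.2 hx) _

lemma fisherF_of_notMem {x : Fin d → ℝ} (hx : x ∉ degenerateSet d) : fisherF x = fisherG x :=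
  Set.indicator_of_mem (s := (degenerateSet d)ᶜ) hx _

lemma continuousOn_fisherF : ContinuousOn (fisherF (d := d)) (degenerateSet d)ᶜ :=
  (continuous_iSup_periodogram.continuousOn.div continuous_sum_periodogram.continuousOn
    fun _ hx => (sum_periodogram_pos hx).ne').congr fun _ hx => fisherF_of_notMem hx

lemma lt_fisherG_iff {x : Fin d → ℝ} (hx : x ∉ degenerateSet d) (k : ℝ) :
    k < fisherG x ↔ ∃ j : Finset.Icc 1 (numFreq d),
      k * ∑ m : Finset.Icc 1 (numFreq d), periodogram x m < periodogram x j := by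
  have : Nonempty (Finset.Icc 1 (numFreq d)) := by
    by_contra hempty
    exact hx fun j hj => (hempty ⟨j, hj⟩).elim
  rw [fisherG, lt_div_iff₀ (sum_periodogram_pos hx), lt_ciSup_iff (Set.finite_range _).bddAbove,
    Finset.sum_coe_sort (Finset.Icc 1 (numFreq d)) (fun m => periodogram x m)]

lemma sum_cexp_fourierFreq_eq_zero {j : ℕ} (hj : j ∈ Finset.Icc 1 (numFreq d)) :
    ∑ l : Fin d, Complex.exp (-Complex.I * (((l : ℕ) + 1 : ℕ) : ℂ) * (fourierFreq d j : ℂ)) =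
      0 := by
  have : NeZero d := ⟨by have := two_mul_lt_of_mem_Icc_numFreq hj; omega⟩
  rw [← (if_neg (mt Int.dvd_neg.1 (not_natCast_dvd hj)) :
      (if (d : ℤ) ∣ -j then (d : ℂ) else 0) = 0), ← sum_cexp_succ_mul_two_pi_mul_div]
  refine Finset.sum_congr rfl fun l _ => ?_
  rw [cexp_neg_I_mul_fourierFreq, fourierFreq]
  congr 3
  push_cast
  ring

lemma periodogram_const_mul_add_const (a b : ℝ) (x : Fin d → ℝ) {j : ℕ}
    (hj : j ∈ Finset.Icc 1 (numFreq d)) :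
    periodogram (fun i => a * x i + b) j = a ^ 2 * periodogram x j := by
  simp only [periodogram, Complex.ofReal_add, Complex.ofReal_mul, add_mul, mul_assoc (a : ℂ),
    Finset.sum_add_distrib, ← Finset.mul_sum, sum_cexp_fourierFreq_eq_zero hj, mul_zero, add_zero,
    norm_mul, mul_pow, Complex.norm_real, Real.norm_eq_abs, sq_abs, mul_left_comm (a ^ 2)]

lemma const_mul_add_const_mem_degenerateSet_iff {a : ℝ} (ha : a ≠ 0) (b : ℝ) (x : Fin d → ℝ) :
    (fun i => a * x i + b) ∈ degenerateSet d ↔ x ∈ degenerateSet d :=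
  forall₂_congr fun j hj => by
    rw [periodogram_const_mul_add_const a b x hj, mul_eq_zero, or_iff_right (pow_ne_zero 2 ha)]

lemma fisherG_const_mul_add_const {a : ℝ} (ha : a ≠ 0) (b : ℝ) (x : Fin d → ℝ) :
    fisherG (fun i => a * x i + b) = fisherG x := by
  rw [fisherG, fisherG, Finset.sum_congr rfl fun j => periodogram_const_mul_add_const a b x,
    ← Finset.mul_sum, iSup_congr fun j => periodogram_const_mul_add_const a b x j.2,
    ← Real.mul_iSup_of_nonneg (sq_nonneg a), mul_div_mul_left _ _ (pow_ne_zero 2 ha)]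

lemma fisherF_const_mul_add_const {a : ℝ} (ha : a ≠ 0) (b : ℝ) (x : Fin d → ℝ) :
    fisherF (fun i => a * x i + b) = fisherF x := by
  have hmem := const_mul_add_const_mem_degenerateSet_iff ha b x
  by_cases hx : x ∈ degenerateSet d
  · rw [fisherF_of_mem hx, fisherF_of_mem (hmem.2 hx)]
  · rw [fisherF_of_notMem hx, fisherF_of_notMem (mt hmem.1 hx), fisherG_const_mul_add_const ha]

lemma measurable_periodograms :
    Measurable fun (x : Fin d → ℝ) (j : Finset.Icc 1 (numFreq d)) => periodogram x j :=
  measurable_pi_lambda _ fun j => (continuous_periodogram j).measurable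

lemma ae_notMem_degenerateSet (hd : 3 ≤ d) :
    ∀ᵐ x ∂Measure.pi fun _ : Fin d => gaussianReal 0 1, x ∉ degenerateSet d := by
  have : NeZero d := ⟨by omega⟩
  have hpos := ae_mem_posOrthant_pi_expMeasure (ι := Finset.Icc 1 (numFreq d)) one_pos
  rw [← map_periodogram_pi_gaussianReal] at hpos
  filter_upwards [ae_of_ae_map measurable_periodograms.aemeasurable hpos] with x hx hmem
  have hone : 1 ∈ Finset.Icc 1 (numFreq d) := by
    rw [Finset.mem_Icc, numFreq]
    omega
  exact (hx ⟨1, hone⟩).ne' (hmem 1 hone)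

lemma two_le_numFreq_iff : 2 ≤ numFreq d ↔ 5 ≤ d := by
  rw [numFreq]
  omega

theorem measureReal_lt_fisherG (hd : 5 ≤ d) {k : ℝ} (hk : 0 ≤ k) :
    (Measure.pi fun _ : Fin d => gaussianReal 0 1).real {x | k < fisherG x} =
      fisherTail (numFreq d) k := by
  have : NeZero d := ⟨by omega⟩
  have hcard : Fintype.card (Finset.Icc 1 (numFreq d)) = numFreq d := by simp
  have : Nontrivial (Finset.Icc 1 (numFreq d)) :=
    Fintype.one_lt_card_iff_nontrivial.1 (hcard.symm ▸ two_le_numFreq_iff.2 hd :)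
  have htail := measureReal_exists_mul_sum_lt (ι := Finset.Icc 1 (numFreq d)) one_pos hk
  rw [hcard, ← map_periodogram_pi_gaussianReal, map_measureReal_apply measurable_periodograms
    (isOpen_exists_mul_sum_lt k).measurableSet] at htail
  rw [← htail]
  refine measureReal_congr ?_
  filter_upwards [ae_notMem_degenerateSet (by omega)] with x hx
  exact propext (lt_fisherG_iff hx k)

lemma measure_singleton_eq_zero_of_continuousWithinAt_cdf {ν : Measure ℝ} [IsProbabilityMeasure ν]
    {k : ℝ} (hk : ContinuousWithinAt (cdf ν) (Set.Iio k) k) : ν {k} = 0 := by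
  rw [← measure_cdf ν, StieltjesFunction.measure_singleton, leftLim_eq_of_tendsto hk.tendsto,
    sub_self, ENNReal.ofReal_zero]

lemma map_fisherG_singleton (hd : 5 ≤ d) {k : ℝ} (hk : 0 < k) :
    (Measure.pi fun _ : Fin d => gaussianReal 0 1).map fisherG {k} = 0 := by
  have := Measure.isProbabilityMeasure_map (μ := Measure.pi fun _ : Fin d => gaussianReal 0 1)
    measurable_fisherG.aemeasurable
  have hcdf (t : ℝ) (ht : 0 < t) :
      cdf ((Measure.pi fun _ : Fin d => gaussianReal 0 1).map fisherG) t =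
        1 - fisherTail (numFreq d) t := by
    rw [cdf_eq_real, ← measureReal_lt_fisherG hd ht.le, ← Set.compl_Ioi,
      probReal_compl_eq_one_sub measurableSet_Ioi,
      map_measureReal_apply measurable_fisherG measurableSet_Ioi]
    rfl
  have hcont : Continuous fun t => 1 - fisherTail (numFreq d) t :=
    continuous_const.sub (continuous_fisherTail _)
  refine measure_singleton_eq_zero_of_continuousWithinAt_cdf
    (hcont.continuousAt.congr ?_).continuousWithinAt
  filter_upwards [Ioi_mem_nhds hk] with t ht using (hcdf t ht).symm

end FisherStatistic

section Convergence

variable {Ω Ω' : Type*} {mΩ : MeasurableSpace Ω} {mΩ' : MeasurableSpace Ω'} {μ : Measure Ω}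
  {μ' : Measure Ω'} [IsProbabilityMeasure μ] [IsProbabilityMeasure μ']

lemma tendsto_map_of_continuousOn_compl {E F ι : Type*} [TopologicalSpace E] [MeasurableSpace E]
    [OpensMeasurableSpace E] [HasOuterApproxClosed E] [TopologicalSpace F] [MeasurableSpace F]
    [BorelSpace F] {l : Filter ι} [l.IsCountablyGenerated] {ν : ι → ProbabilityMeasure E}
    {ν₀ : ProbabilityMeasure E} (hν : Tendsto ν l (𝓝 ν₀)) {f : E → F} (hf : Measurable f)
    {A : Set E} (hA : IsClosed A) (hfA : ContinuousOn f Aᶜ) (hnull : (ν₀ : Measure E) A = 0) :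
    Tendsto (fun n => (ν n).map hf.aemeasurable) l (𝓝 (ν₀.map hf.aemeasurable)) := by
  refine tendsto_of_forall_isOpen_le_liminf' fun G hG => ?_
  have hopen : IsOpen (Aᶜ ∩ f ⁻¹' G) := hfA.isOpen_inter_preimage hA.isOpen_compl hG
  simp only [ProbabilityMeasure.toMeasure_map, Measure.map_apply hf hG.measurableSet]
  calc (ν₀ : Measure E) (f ⁻¹' G) = (ν₀ : Measure E) (Aᶜ ∩ f ⁻¹' G) := by
        rw [Set.inter_comm, ← Set.sdiff_eq, measure_sdiff_null hnull]
    _ ≤ liminf (fun n => (ν n : Measure E) (Aᶜ ∩ f ⁻¹' G)) l :=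
        ProbabilityMeasure.le_liminf_measure_open_of_tendsto hν hopen
    _ ≤ liminf (fun n => (ν n : Measure E) (f ⁻¹' G)) l :=
        liminf_le_liminf (.of_forall fun n => measure_mono Set.inter_subset_right)

lemma tendstoInDistribution_comp_of_continuousOn_compl {E F ι : Type*} [TopologicalSpace E]
    [MeasurableSpace E] [OpensMeasurableSpace E] [HasOuterApproxClosed E] [TopologicalSpace F]
    [MeasurableSpace F] [BorelSpace F] {l : Filter ι} [l.IsCountablyGenerated] {X : ι → Ω → E}
    {Z : Ω' → E} (hX : TendstoInDistribution X l Z (fun _ => μ) μ') {f : E → F}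
    (hf : Measurable f) {A : Set E} (hA : IsClosed A) (hfA : ContinuousOn f Aᶜ)
    (hZ : ∀ᵐ ω ∂μ', Z ω ∉ A) :
    TendstoInDistribution (fun n ω => f (X n ω)) l (fun ω => f (Z ω)) (fun _ => μ) μ' where
  forall_aemeasurable n := hf.comp_aemeasurable (hX.forall_aemeasurable n)
  aemeasurable_limit := hf.comp_aemeasurable hX.aemeasurable_limit
  tendsto := by
    have hnull : μ'.map Z A = 0 := by
      rwa [Measure.map_apply_of_aemeasurable hX.aemeasurable_limit hA.measurableSet,
        measure_eq_zero_iff_ae_notMem]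
    simpa only [ProbabilityMeasure.map, ProbabilityMeasure.coe_mk, Function.comp_def,
      AEMeasurable.map_map_of_aemeasurable hf.aemeasurable hX.aemeasurable_limit,
      AEMeasurable.map_map_of_aemeasurable hf.aemeasurable (hX.forall_aemeasurable _)]
      using tendsto_map_of_continuousOn_compl hX.tendsto hf hA hfA hnull

lemma tendstoInDistribution_pi {ι κ : Type*} [Finite κ] {E : κ → Type*}
    [∀ k, TopologicalSpace (E k)] [∀ k, TopologicalSpace.PseudoMetrizableSpace (E k)]
    [∀ k, SecondCountableTopology (E k)] [∀ k, MeasurableSpace (E k)] [∀ k, BorelSpace (E k)]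
    {l : Filter ι} {X : ι → Ω → ∀ k, E k} {Z : Ω' → ∀ k, E k}
    (hX : ∀ n, iIndepFun (fun k ω => X n ω k) μ) (hZ : iIndepFun (fun k ω => Z ω k) μ')
    (h : ∀ k, TendstoInDistribution (fun n ω => X n ω k) l (fun ω => Z ω k) (fun _ => μ) μ') :
    TendstoInDistribution X l Z (fun _ => μ) μ' where
  forall_aemeasurable n := aemeasurable_pi_iff.2 fun k => (h k).forall_aemeasurable n
  aemeasurable_limit := aemeasurable_pi_iff.2 fun k => (h k).aemeasurable_limit
  tendsto := by
    cases nonempty_fintype κ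
    simp only [(iIndepFun_iff_map_fun_eq_pi_map fun k => (h k).forall_aemeasurable _).1 (hX _),
      (iIndepFun_iff_map_fun_eq_pi_map fun k => (h k).aemeasurable_limit).1 hZ]
    exact (ProbabilityMeasure.continuous_pi.tendsto _).comp
      (tendsto_pi_nhds.2 fun k => (h k).tendsto)

lemma tendsto_measureReal_lt_of_tendstoInDistribution {ι E : Type*} {l : Filter ι}
    [TopologicalSpace E] [LinearOrder E] [OrderTopology E] [DenselyOrdered E] [NoMaxOrder E]
    [MeasurableSpace E] [BorelSpace E] [HasOuterApproxClosed E] {X : ι → Ω → E} {Z : Ω' → E}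
    (h : TendstoInDistribution X l Z (fun _ => μ) μ') {k : E} (hk : μ'.map Z {k} = 0) :
    Tendsto (fun n => μ.real {ω | k < X n ω}) l (𝓝 (μ'.real {ω | k < Z ω})) := by
  have hlim := ProbabilityMeasure.tendsto_measure_of_null_frontier_of_tendsto' h.tendsto
    (E := Set.Ioi k) (by rwa [frontier_Ioi])
  simp only [ProbabilityMeasure.coe_mk,
    Measure.map_apply_of_aemeasurable h.aemeasurable_limit measurableSet_Ioi,
    Measure.map_apply_of_aemeasurable (h.forall_aemeasurable _) measurableSet_Ioi] at hlim
  exact (ENNReal.tendsto_toReal (measure_ne_top μ' _)).comp hlim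

end Convergence

lemma iIndepFun_curry {Ω ι κ β : Type*} [Countable ι] [Countable κ] {mΩ : MeasurableSpace Ω}
    {mβ : MeasurableSpace β} {P : Measure Ω} {X : ι → κ → Ω → β}
    (mX : ∀ i k, AEMeasurable (X i k) P) (h : iIndepFun (fun (p : ι × κ) ω => X p.1 p.2 ω) P) :
    iIndepFun (fun i ω k => X i k ω) P := by
  have := h.isProbabilityMeasure
  have hprob (i : ι) (k : κ) : IsProbabilityMeasure (P.map (X i k)) :=
    Measure.isProbabilityMeasure_map (mX i k)
  have hrow (i : ι) : P.map (fun ω k => X i k ω) = Measure.infinitePi fun k => P.map (X i k) :=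
    (h.precomp (g := fun k => (i, k)) (Prod.mk_right_injective i)).map_fun_eq_infinitePi_map₀'
      (mX i)
  have hall := h.map_fun_eq_infinitePi_map₀' fun p : ι × κ => mX p.1 p.2
  rw [iIndepFun_iff_map_fun_eq_infinitePi_map₀' fun i => aemeasurable_pi_iff.2 (mX i)]
  simp only [hrow]
  rw [← Measure.infinitePi_map_curry, ← hall, AEMeasurable.map_map_of_aemeasurable
    (by fun_prop) (aemeasurable_pi_iff.2 fun p : ι × κ => mX p.1 p.2)]
  rfl

section BlockMean

/-- The block sums of `Y`, centred at `c` and divided by the square root of the number `m` of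
summands: the normalization of the block means for which the central limit theorem holds. -/
noncomputable def normalizedBlockSum {Ω : Type*} (Y : ℕ → Ω → ℝ) (c : ℝ) (d m : ℕ) (ω : Ω) :
    Fin d → ℝ :=
  fun i => (√m)⁻¹ * (∑ k ∈ Finset.range m, Y (i + k * d) ω - m * c)

lemma fisherF_blockMean {Ω : Type*} (Y : ℕ → Ω → ℝ) (c : ℝ) (d n : ℕ) (ω : Ω) :
    fisherF (blockMean Y d n ω) = fisherF (normalizedBlockSum Y c d (n / d) ω) := by
  rcases Nat.eq_zero_or_pos (n / d) with hm | hm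
  · congr 1 with i
    simp [blockMean, normalizedBlockSum, hm]
  · have hpos : 0 < ((n / d : ℕ) : ℝ) := Nat.cast_pos.2 hm
    rw [← fisherF_const_mul_add_const (Real.sqrt_pos.2 hpos).ne' (-(√(n / d : ℕ) * c))]
    congr 1 with i
    rw [blockMean, normalizedBlockSum, ← Real.sqrt_div_self]
    field_simp
    ring

lemma injective_blockIndex (d : ℕ) :
    Function.Injective fun p : Fin d × ℕ => (p.1 : ℕ) + p.2 * d := by
  rintro ⟨i, k⟩ ⟨i', k'⟩ h
  have hmod (i : Fin d) (k : ℕ) : (i + k * d) % d = i := by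
    rw [Nat.add_mul_mod_self_right, Nat.mod_eq_of_lt i.2]
  have hdiv (i : Fin d) (k : ℕ) : (i + k * d) / d = k := by
    rw [Nat.add_mul_div_right _ _ i.pos, Nat.div_eq_of_lt i.2, zero_add]
  exact Prod.ext (Fin.ext (by rw [← hmod i k, ← hmod i' k']; exact congrArg (· % d) h))
    (by rw [← hdiv i k, ← hdiv i' k']; exact congrArg (· / d) h)

variable {Ω Ω' : Type*} {mΩ : MeasurableSpace Ω} {mΩ' : MeasurableSpace Ω'} {μ : Measure Ω}
  {μ' : Measure Ω'} {Y : ℕ → Ω → ℝ} {d : ℕ}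

lemma iIndepFun_normalizedBlockSum (hYm : ∀ ℓ, AEMeasurable (Y ℓ) μ) (hY : iIndepFun Y μ) (c : ℝ)
    (d m : ℕ) : iIndepFun (fun i ω => normalizedBlockSum Y c d m ω i) μ :=
  (iIndepFun_curry (X := fun (i : Fin d) k => Y (i + k * d)) (fun _ _ => hYm _)
    (hY.precomp (injective_blockIndex d))).comp
    (fun _ y => (√m)⁻¹ * (∑ k ∈ Finset.range m, y k - m * c)) fun _ => by fun_prop

lemma tendstoInDistribution_normalizedBlockSum [IsProbabilityMeasure μ] [IsProbabilityMeasure μ']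
    (hY : iIndepFun Y μ) (hident : ∀ ℓ, IdentDistrib (Y ℓ) (Y 0) μ μ) (hL2 : MemLp (Y 0) 2 μ)
    {Z : Fin d → Ω' → ℝ} (hZind : iIndepFun Z μ')
    (hZ : ∀ i, HasLaw (Z i) (gaussianReal 0 Var[Y 0; μ].toNNReal) μ') :
    TendstoInDistribution (fun m ω => normalizedBlockSum Y μ[Y 0] d m ω) atTop
      (fun ω i => Z i ω) (fun _ => μ) μ' := by
  refine tendstoInDistribution_pi
    (iIndepFun_normalizedBlockSum (fun ℓ => (hident ℓ).aemeasurable_fst) hY _ d) hZind fun i => ?_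
  have hblock (k : ℕ) : IdentDistrib (Y (i + k * d)) (Y (i + 0 * d)) μ μ :=
    (hident _).trans (hident _).symm
  have hvar : Var[Y (i + 0 * d); μ] = Var[Y 0; μ] := (hident _).variance_eq
  have hmean : μ[Y (i + 0 * d)] = μ[Y 0] := (hident _).integral_eq
  simpa only [hmean, normalizedBlockSum] using tendstoInDistribution_inv_sqrt_mul_sum_sub
    (X := fun k => Y (i + k * d)) (hvar ▸ hZ i) ((hident _).memLp_iff.2 hL2)
    (hY.precomp ((injective_blockIndex d).comp (Prod.mk_right_injective i))) hblock

lemma ae_notMem_degenerateSet_of_iIndepFun (hd : 3 ≤ d) {N : Fin d → Ω' → ℝ}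
    (hNind : iIndepFun N μ') (hN : ∀ i, HasLaw (N i) (gaussianReal 0 1) μ') :
    ∀ᵐ ω ∂μ', (fun i => N i ω) ∉ degenerateSet d := by
  have hlaw := hNind.hasLaw_pi hN
  have hae := ae_notMem_degenerateSet hd
  rw [← hlaw.map_eq] at hae
  exact ae_of_ae_map hlaw.aemeasurable hae

lemma hasLaw_sqrt_mul_gaussianReal {X : Ω → ℝ} (hX : HasLaw X (gaussianReal 0 1) μ) (v : NNReal) :
    HasLaw (fun ω => √v * X ω) (gaussianReal 0 v) μ := by
  have hv : NNReal.mk (√v ^ 2) (sq_nonneg _) = v := NNReal.eq (Real.sq_sqrt v.2)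
  simpa only [mul_zero, mul_one, hv] using gaussianReal_const_mul hX √v

theorem tendstoInDistribution_fisherF_blockMean [IsProbabilityMeasure μ] [IsProbabilityMeasure μ']
    (hY : iIndepFun Y μ) (hident : ∀ ℓ, IdentDistrib (Y ℓ) (Y 0) μ μ) (hvar : Var[Y 0; μ] ≠ 0)
    (hd : 3 ≤ d) {N : Fin d → Ω' → ℝ} (hNind : iIndepFun N μ')
    (hN : ∀ i, HasLaw (N i) (gaussianReal 0 1) μ') :
    TendstoInDistribution (fun n ω => fisherF (blockMean Y d n ω)) atTop
      (fun ω => fisherG fun i => N i ω) (fun _ => μ) μ' := by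
  let σ := √Var[Y 0; μ].toNNReal
  have hσ : σ ≠ 0 := (Real.sqrt_pos.2 (Real.toNNReal_pos.2
    ((variance_nonneg _ _).lt_of_ne' hvar))).ne'
  have hσN_mem (ω : Ω') :
      (fun i => σ * N i ω) ∈ degenerateSet d ↔ (fun i => N i ω) ∈ degenerateSet d := by
    simpa only [add_zero] using const_mul_add_const_mem_degenerateSet_iff hσ 0 fun i => N i ω
  have hσN_fisherF (ω : Ω') : fisherF (fun i => σ * N i ω) = fisherF fun i => N i ω := by
    simpa only [add_zero] using fisherF_const_mul_add_const hσ 0 fun i => N i ω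
  have hN_notMem := ae_notMem_degenerateSet_of_iIndepFun hd hNind hN
  have hclt : TendstoInDistribution (fun m ω => normalizedBlockSum Y μ[Y 0] d m ω) atTop
      (fun ω i => σ * N i ω) (fun _ => μ) μ' :=
    tendstoInDistribution_normalizedBlockSum hY hident
      (memLp_two_of_variance_ne_zero (hident 0).aemeasurable_fst.aestronglyMeasurable hvar)
      (hNind.comp (fun _ t => σ * t) fun _ => by fun_prop)
      fun i => hasLaw_sqrt_mul_gaussianReal (hN i) _
  have hstat := tendstoInDistribution_comp_of_continuousOn_compl hclt measurable_fisherF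
    isClosed_degenerateSet continuousOn_fisherF (by simpa only [hσN_mem] using hN_notMem)
  have hblock : TendstoInDistribution
      (fun n ω => fisherF (normalizedBlockSum Y μ[Y 0] d (n / d) ω)) atTop
      (fun ω => fisherF fun i => σ * N i ω) (fun _ => μ) μ' :=
    ⟨fun n => hstat.forall_aemeasurable (n / d), hstat.aemeasurable_limit,
      hstat.tendsto.comp (Nat.tendsto_div_const_atTop (by lia))⟩
  refine hblock.congr (fun n => .of_forall fun ω => (fisherF_blockMean Y _ d n ω).symm) ?_
  filter_upwards [hN_notMem] with ω hω
  rw [hσN_fisherF, fisherF_of_notMem hω]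

end BlockMean

lemma hasLaw_bernoulliMeasure {Ω E : Type*} {mΩ : MeasurableSpace Ω} {mE : MeasurableSpace E}
    [MeasurableSingletonClass E] {μ : Measure Ω} [IsProbabilityMeasure μ] {U : Ω → E}
    (hU : Measurable U) {x y : E} (hxy : ∀ ω, U ω = x ∨ U ω = y) {p : unitInterval}
    (hp : μ.real {ω | U ω = x} = p) : HasLaw U (bernoulliMeasure x y p) μ where
  map_eq := by
    set S := {ω | U ω = x}
    have hS : MeasurableSet S := hU (measurableSet_singleton x)
    have hμS : μ S = unitInterval.toNNReal p := by
      rw [← ENNReal.toReal_eq_toReal_iff' (measure_ne_top _ _) ENNReal.coe_ne_top]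
      exact hp
    have hμSc : μ Sᶜ = unitInterval.toNNReal (unitInterval.symm p) := by
      rw [← ENNReal.toReal_eq_toReal_iff' (measure_ne_top _ _) ENNReal.coe_ne_top]
      exact (probReal_compl_eq_one_sub hS).trans (by rw [hp]; rfl)
    have hx : U =ᵐ[μ.restrict S] fun _ => x := ae_restrict_mem hS
    have hy : U =ᵐ[μ.restrict Sᶜ] fun _ => y :=
      (ae_restrict_mem hS.compl).mono fun ω hω => (hxy ω).resolve_left hω
    calc μ.map U = (μ.restrict S + μ.restrict Sᶜ).map U := by
          rw [Measure.restrict_add_restrict_compl hS]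
      _ = μ S • Measure.dirac x + μ Sᶜ • Measure.dirac y := by
          rw [Measure.map_add _ _ hU, Measure.map_congr hx, Measure.map_congr hy,
            Measure.map_const, Measure.map_const, Measure.restrict_apply_univ,
            Measure.restrict_apply_univ]
      _ = bernoulliMeasure x y p := by
          rw [hμS, hμSc]
          rfl

lemma variance_bernoulliMeasure (x y : ℝ) (p : unitInterval) :
    Var[id; bernoulliMeasure x y p] = p * (1 - p) * (x - y) ^ 2 := by
  rw [variance_eq_integral aemeasurable_id]
  simp only [integral_bernoulliMeasure, id_eq, smul_eq_mul]
  ring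

lemma variance_bernoulliMeasure_ne_zero {x y : ℝ} (hxy : x ≠ y) {p : unitInterval} (hp0 : 0 < p)
    (hp1 : p < 1) : Var[id; bernoulliMeasure x y p] ≠ 0 := by
  rw [variance_bernoulliMeasure]
  have hp0' : (0 : ℝ) < p := hp0
  have hp1' : (0 : ℝ) < 1 - p := sub_pos.2 hp1
  exact mul_ne_zero (mul_pos hp0' hp1').ne' (pow_ne_zero 2 (sub_ne_zero.2 hxy))

theorem tendsto_measureReal_lt_fisherF_blockMean {Ω : Type*} {mΩ : MeasurableSpace Ω}
    {μ : Measure Ω} [IsProbabilityMeasure μ] {Y : ℕ → Ω → ℝ} (hY : iIndepFun Y μ)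
    (hident : ∀ ℓ, IdentDistrib (Y ℓ) (Y 0) μ μ) (hvar : Var[Y 0; μ] ≠ 0) {d : ℕ} (hd : 3 ≤ d)
    {k : ℝ} (hk : fisherTail (numFreq d) k ∈ Set.Ioo 0 1) :
    Tendsto (fun n => μ.real {ω | k < fisherF (blockMean Y d n ω)}) atTop
      (𝓝 (fisherTail (numFreq d) k)) := by
  have hq_ne : numFreq d ≠ 1 := fun hq => by
    rw [hq, fisherTail_one] at hk
    exact hk.2.false
  have hq : 2 ≤ numFreq d := by
    unfold numFreq at hq_ne ⊢
    lia
  have hd5 : 5 ≤ d := two_le_numFreq_iff.1 hq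
  have hk0 : 0 < k := (by positivity : (0 : ℝ) ≤ (numFreq d : ℝ)⁻¹).trans_lt
    (mem_Ioo_of_fisherTail_mem_Ioo hq hk).1
  rw [← measureReal_lt_fisherG hd5 hk0.le]
  exact tendsto_measureReal_lt_of_tendstoInDistribution
    (tendstoInDistribution_fisherF_blockMean hY hident hvar hd iIndepFun_eval_pi_gaussianReal
      hasLaw_eval_pi_gaussianReal) (map_fisherG_singleton hd5 hk0)

end BinaryPeriodicity

theorem mainTheorem1_general {Ω : Type*} [MeasurableSpace Ω] (μ : Measure Ω)
    [IsProbabilityMeasure μ] (Y : ℕ → Ω → ℝ) (hYind : iIndepFun Y μ)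
    (hident : ∀ ℓ, IdentDistrib (Y ℓ) (Y 0) μ μ) (hvar : Var[Y 0; μ] ≠ 0)
    (d : ℕ) (hd : 3 ≤ d) :
    (∀ {Ω' : Type*} [MeasurableSpace Ω'] (μ' : Measure Ω') [IsProbabilityMeasure μ']
        (N : Fin d → Ω' → ℝ), iIndepFun N μ' → (∀ i, HasLaw (N i) (gaussianReal 0 1) μ') →
        (∀ᵐ ω' ∂μ', (fun i => N i ω') ∉ BinaryPeriodicity.degenerateSet d) ∧
        TendstoInDistribution
          (fun n ω => BinaryPeriodicity.fisherF (BinaryPeriodicity.blockMean Y d n ω)) atTop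
          (fun ω' => BinaryPeriodicity.fisherG (fun i => N i ω')) (fun _ => μ) μ') ∧
    (∀ α : ℝ, 0 < α → α < 1 →
        (5 ≤ d → ∃! k : ℝ, BinaryPeriodicity.fisherTail (BinaryPeriodicity.numFreq d) k = α) ∧
        ∀ k : ℝ, BinaryPeriodicity.fisherTail (BinaryPeriodicity.numFreq d) k = α →
          Tendsto (fun n : ℕ =>
              μ.real {ω | k < BinaryPeriodicity.fisherF (BinaryPeriodicity.blockMean Y d n ω)})
            atTop (𝓝 α)) :=
  ⟨fun _ _ _ hNind hN => ⟨BinaryPeriodicity.ae_notMem_degenerateSet_of_iIndepFun hd hNind hN,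
      BinaryPeriodicity.tendstoInDistribution_fisherF_blockMean hYind hident hvar hd hNind hN⟩,
    fun _ hα0 hα1 => ⟨fun hd5 => BinaryPeriodicity.existsUnique_fisherTail_eq
        (BinaryPeriodicity.two_le_numFreq_iff.2 hd5) ⟨hα0, hα1⟩,
      fun _ hk => hk ▸ BinaryPeriodicity.tendsto_measureReal_lt_fisherF_blockMean hYind hident hvar
        hd (hk ▸ ⟨hα0, hα1⟩)⟩⟩

theorem mainTheorem1 {Ω : Type*} [MeasurableSpace Ω] (μ : Measure Ω)
    [IsProbabilityMeasure μ] (Y : ℕ → Ω → ℝ) (hYm : ∀ ℓ, Measurable (Y ℓ))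
    (hY01 : ∀ ℓ ω, Y ℓ ω = 0 ∨ Y ℓ ω = 1) (hYind : iIndepFun Y μ)
    (p : ℝ) (hp0 : 0 < p) (hp1 : p < 1) (hYp : ∀ ℓ, μ.real {ω | Y ℓ ω = 1} = p)
    (d : ℕ) (hd : 3 ≤ d) :
    (∀ {Ω' : Type*} [MeasurableSpace Ω'] (μ' : Measure Ω') [IsProbabilityMeasure μ']
        (N : Fin d → Ω' → ℝ), iIndepFun N μ' → (∀ i, HasLaw (N i) (gaussianReal 0 1) μ') →
        (∀ᵐ ω' ∂μ', (fun i => N i ω') ∉ BinaryPeriodicity.degenerateSet d) ∧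
        TendstoInDistribution
          (fun n ω => BinaryPeriodicity.fisherF (BinaryPeriodicity.blockMean Y d n ω)) atTop
          (fun ω' => BinaryPeriodicity.fisherG (fun i => N i ω')) (fun _ => μ) μ') ∧
    (∀ α : ℝ, 0 < α → α < 1 →
        (5 ≤ d → ∃! k : ℝ, BinaryPeriodicity.fisherTail (BinaryPeriodicity.numFreq d) k = α) ∧
        ∀ k : ℝ, BinaryPeriodicity.fisherTail (BinaryPeriodicity.numFreq d) k = α →
          Tendsto (fun n : ℕ =>
              μ.real {ω | k < BinaryPeriodicity.fisherF (BinaryPeriodicity.blockMean Y d n ω)})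
            atTop (𝓝 α)) := by
  have hlaw (ℓ : ℕ) := BinaryPeriodicity.hasLaw_bernoulliMeasure (hYm ℓ) (fun ω => (hY01 ℓ ω).symm)
    (p := ⟨p, hp0.le, hp1.le⟩) (hYp ℓ)
  exact mainTheorem1_general μ Y hYind (fun ℓ => (hlaw ℓ).identDistrib (hlaw 0))
    ((hlaw 0).variance_eq ▸ BinaryPeriodicity.variance_bernoulliMeasure_ne_zero one_ne_zero hp0 hp1)
    d hd
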